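/- Theorem 5.1. There is a universal constant $C>0$ such that the following holds for every integer $n\ge 1$ and every real $\beta>n$. Let $V:\mathbb{R}^n\to(0,\infty]$ be a positive convex function, possibly taking the value $+\infty$, such that $$d\mu(x)=V(x)^{-\beta}\,dx\qquad(\text{with } \infty^{-\beta}=0)$$ is a probability measure on $\mathbb{R}^n$. Then there is a unique $r>0$ with $\mu(\{x:|x|\le r\})=2/3$, where $|\cdot|$ is the Euclidean norm, and for this $r$ and for every bounded $C^\infty$ function $g:\mathbb{R}^n\to\mathbb{R}$, $$\operatorname{Var}_\mu(g)\;\le\; C\left(\frac{\beta-n+1}{\beta-n}\right)^{2}\int_{\mathbb{R}^n}|\nabla g(x)|^2\,(r^2+|x|^2)\,d\mu(x),$$ where $\operatorname{Var}_\mu(g)=\int g^2\,d\mu-\left(\int g\,d\mu\right)^2$ and the right-hand side may be $+\infty$. -/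

import Mathlib

open MeasureTheory ProbabilityTheory
open scoped ENNReal NNReal ContDiff

/-- The measure on `ℝⁿ` with density `V ^ (-β)` with respect to Lebesgue measure. For `β > 0` the
density vanishes where `V = ∞`. -/
noncomputable def convexPowerMeasure (n : ℕ) (β : ℝ) (V : EuclideanSpace ℝ (Fin n) → ℝ≥0∞) :
    Measure (EuclideanSpace ℝ (Fin n)) :=
  volume.withDensity (fun x => V x ^ (-β))

/-!
The argument follows Borell and Bobkov. The Borell–Brascamp–Lieb inequality
(`powMean_lintegral_le`), proved by induction on the dimension from the Brunn–Minkowski inequality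
on the line and Hölder's inequality, gives for `μ = V ^ (-β) dx` and `α = β - n`
`μ ((1 - t) A + t B) ≥ ((1 - t) μ(A) ^ (-1/α) + t μ(B) ^ (-1/α)) ^ (-α)`
(`powMean_convexPowerMeasure_le`). Take for `B` the ball of radius `r`, of measure `2/3`, and
`μ(A) ≤ 1/2`. The right-hand side is convex in `t`, so it lies above its tangent at `t = 0`, which
makes the measure of `A` grow at a rate `c = α / (4 (α + 1))` at least (`mul_le_powMean`).

Mixing with the ball moves a point `x` by at most `t (r + ‖x‖)`, so that integrating this expansion
over the superlevel sets of a function and letting `t → 0` yields the weighted Cheeger inequality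
`c ∫ f dμ ≤ ∫ ‖∇f‖ (r + ‖x‖) dμ` for `f ≥ 0` with `μ {f > 0} ≤ 1/2`
(`mul_integral_le_of_expansion`). Applied to the squares of the positive and negative parts of
`g - m`, where `m` is a median of `g`, it becomes the weighted Poincaré inequality
(`variance_le_of_weighted_cheeger`). A smooth cutoff at scale `k` costs nothing in the limit, because
its gradient is `O(1/k)` and lives where the weight is `O(k)`.

The radius exists because spheres are null, and it is unique because there is no gap in the mass:
a segment between interior points of the convex set `{V < ∞}` on either side of a spherical shell
crosses that shell (`convexPowerMeasure_shell_pos`).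
-/

/-! ### Power means of negative order -/

/-- The power mean `(u a ^ (-1/γ) + v b ^ (-1/γ)) ^ (-γ)` of `a` and `b` of order `-1/γ`, with
weights `u` and `v`. For `γ > 0` and `u, v > 0`, the conventions of `ℝ≥0∞` (`0 ^ (-1/γ) = ∞` and
`∞ ^ (-γ) = 0`) make it vanish as soon as `a = 0` or `b = 0`. -/
noncomputable def powMean (γ : ℝ) (u v : ℝ≥0) (a b : ℝ≥0∞) : ℝ≥0∞ :=
  (u * a ^ (-γ⁻¹) + v * b ^ (-γ⁻¹)) ^ (-γ)

theorem ENNReal.rpow_le_rpow_of_nonpos {x y : ℝ≥0∞} {z : ℝ} (h : x ≤ y) (hz : z ≤ 0) :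
    y ^ z ≤ x ^ z := by
  rw [← neg_neg z, ENNReal.rpow_neg, ENNReal.rpow_neg x]
  exact ENNReal.inv_le_inv.2 (ENNReal.rpow_le_rpow h (by linarith))

theorem powMean_mono {γ : ℝ} (hγ : 0 < γ) (u v : ℝ≥0) {a b a' b' : ℝ≥0∞} (ha : a ≤ a')
    (hb : b ≤ b') : powMean γ u v a b ≤ powMean γ u v a' b' := by
  have h : -γ⁻¹ ≤ 0 := by simpa using hγ.le
  refine ENNReal.rpow_le_rpow_of_nonpos ?_ (by linarith)
  exact add_le_add (mul_le_mul_right (ENNReal.rpow_le_rpow_of_nonpos ha h) _)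
    (mul_le_mul_right (ENNReal.rpow_le_rpow_of_nonpos hb h) _)

theorem powMean_zero_left {γ : ℝ} (hγ : 0 < γ) {u : ℝ≥0} (hu : 0 < u) (v : ℝ≥0) (b : ℝ≥0∞) :
    powMean γ u v 0 b = 0 := by
  have h : -γ⁻¹ < 0 := by simpa using hγ
  rw [powMean, ENNReal.zero_rpow_of_neg h, ENNReal.mul_top (by simpa using hu.ne'), top_add,
    ENNReal.top_rpow_of_neg (by linarith)]

theorem powMean_zero_right {γ : ℝ} (hγ : 0 < γ) (u : ℝ≥0) {v : ℝ≥0} (hv : 0 < v) (a : ℝ≥0∞) :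
    powMean γ u v a 0 = 0 := by
  have h : -γ⁻¹ < 0 := by simpa using hγ
  rw [powMean, ENNReal.zero_rpow_of_neg h, ENNReal.mul_top (by simpa using hv.ne'), add_top,
    ENNReal.top_rpow_of_neg (by linarith)]

theorem powMean_self {γ : ℝ} (hγ : 0 < γ) {u v : ℝ≥0} (huv : u + v = 1) (a : ℝ≥0∞) :
    powMean γ u v a a = a := by
  rw [powMean, ← add_mul, ← ENNReal.coe_add, huv, ENNReal.coe_one, one_mul, ← ENNReal.rpow_mul]
  simp [hγ.ne']

theorem powMean_smul {γ : ℝ} (hγ : 0 < γ) (u v : ℝ≥0) (a b : ℝ≥0∞) {s : ℝ≥0∞} (hs0 : s ≠ 0)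
    (hs : s ≠ ⊤) : powMean γ u v (s * a) (s * b) = s * powMean γ u v a b := by
  have key : ∀ c : ℝ≥0∞, (s * c) ^ (-γ⁻¹) = s ^ (-γ⁻¹) * c ^ (-γ⁻¹) := by
    intro c
    rw [ENNReal.rpow_neg, ENNReal.mul_rpow_of_nonneg _ _ (by positivity), ENNReal.mul_inv,
      ENNReal.rpow_neg, ENNReal.rpow_neg]
    · left; simp [hs0, hs]
    · left; simp [hs0, hs]
  have key2 : ∀ c : ℝ≥0∞, (s ^ (-γ⁻¹) * c) ^ (-γ) = s * c ^ (-γ) := by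
    intro c
    rw [ENNReal.rpow_neg, ENNReal.mul_rpow_of_nonneg _ _ hγ.le, ENNReal.mul_inv,
      ENNReal.rpow_neg c, ← ENNReal.rpow_mul, ← ENNReal.rpow_neg]
    · simp [hγ.ne']
    · left; simp [hs0, hs]
    · left; simp [hs0, hs]
  rw [powMean, key, key, mul_left_comm, mul_left_comm (v : ℝ≥0∞), ← mul_add, key2, powMean]

theorem powMean_ne_zero {γ : ℝ} (hγ : 0 < γ) (u v : ℝ≥0) {a b : ℝ≥0∞} (ha : a ≠ 0) (hb : b ≠ 0) :
    powMean γ u v a b ≠ 0 := by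
  have h : ∀ c : ℝ≥0∞, c ≠ 0 → c ^ (-γ⁻¹) ≠ ⊤ := by
    intro c hc
    rw [ENNReal.rpow_neg]
    simp [hc, hγ, hγ.le]
  rw [powMean, ENNReal.rpow_neg, ENNReal.inv_ne_zero]
  exact ENNReal.rpow_ne_top_of_nonneg hγ.le
    (ENNReal.add_ne_top.2 ⟨ENNReal.mul_ne_top (by simp) (h a ha),
      ENNReal.mul_ne_top (by simp) (h b hb)⟩)

theorem powMean_ne_top {γ : ℝ} (hγ : 0 < γ) {u v : ℝ≥0} (huv : u + v = 1) {a b : ℝ≥0∞}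
    (ha : a ≠ ⊤) (hb : b ≠ ⊤) : powMean γ u v a b ≠ ⊤ := by
  refine ne_top_of_le_ne_top (b := max a b) (by simp [ha, hb]) ?_
  rw [← powMean_self hγ huv (max a b)]
  exact powMean_mono hγ u v (le_max_left _ _) (le_max_right _ _)

theorem powMean_tendsto {ι : Type*} {l : Filter ι} (γ : ℝ) (u v : ℝ≥0) {A B : ι → ℝ≥0∞}
    {a b : ℝ≥0∞} (hA : Filter.Tendsto A l (nhds a)) (hB : Filter.Tendsto B l (nhds b)) :
    Filter.Tendsto (fun i => powMean γ u v (A i) (B i)) l (nhds (powMean γ u v a b)) := by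
  refine (ENNReal.continuous_rpow_const.tendsto _).comp ?_
  refine Filter.Tendsto.add ?_ ?_
  · exact ENNReal.Tendsto.const_mul ((ENNReal.continuous_rpow_const.tendsto _).comp hA)
      (Or.inr (by simp))
  · exact ENNReal.Tendsto.const_mul ((ENNReal.continuous_rpow_const.tendsto _).comp hB)
      (Or.inr (by simp))

/-- Hölder's inequality for power means: a mean of order `-1/γ` times a mean of order `1` dominates
the mean of the products of order `-1/(γ-1)`. -/
theorem powMean_mul_le {γ : ℝ} (hγ : 1 < γ) {u v : ℝ≥0} (hu : 0 < u) (hv : 0 < v)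
    {a b : ℝ≥0∞} (ha0 : a ≠ 0) (hb0 : b ≠ 0) (ha : a ≠ ⊤) (hb : b ≠ ⊤) (A B : ℝ≥0∞) :
    powMean (γ - 1) u v (a * A) (b * B) ≤ powMean γ u v a b * (u * A + v * B) := by
  have hγ1 : 0 < γ - 1 := by linarith
  have hγ0 : 0 < γ := by linarith
  have hu' : (u : ℝ≥0∞) ≠ 0 := by simpa using hu.ne'
  have hv' : (v : ℝ≥0∞) ≠ 0 := by simpa using hv.ne'
  rcases eq_or_ne A 0 with rfl | hA0
  · simp [powMean_zero_left hγ1 hu]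
  rcases eq_or_ne B 0 with rfl | hB0
  · simp [powMean_zero_right hγ1 u hv]
  have hM := powMean_ne_zero hγ0 u v ha0 hb0
  rcases eq_or_ne A ⊤ with rfl | hA
  · rw [ENNReal.mul_top hu', top_add, ENNReal.mul_top hM]; exact le_top
  rcases eq_or_ne B ⊤ with rfl | hB
  · rw [ENNReal.mul_top hv', add_top, ENNReal.mul_top hM]; exact le_top
  set δ := (γ - 1)⁻¹ with hδ
  have hδ0 : 0 < δ := inv_pos.2 hγ1
  have hp1 : γ⁻¹ * (1 + δ) = δ := by rw [hδ]; field_simp; ring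
  have hp2 : 1 - (1 + δ)⁻¹ = γ⁻¹ := by rw [hδ]; field_simp; ring
  have hp3 : (1 + δ)⁻¹ * γ = γ - 1 := by rw [hδ]; field_simp; ring
  have term : ∀ {w c C : ℝ≥0∞}, c ≠ 0 → c ≠ ⊤ → C ≠ 0 → C ≠ ⊤ →
      w * C * (C⁻¹ * c ^ (-γ⁻¹)) = w * c ^ (-γ⁻¹) ∧
      w * C * (C⁻¹ * c ^ (-γ⁻¹)) ^ (1 + δ) = w * (c * C) ^ (-δ) := by
    intro w c C hc0 hc hC0 hC
    constructor
    · rw [mul_assoc, ← mul_assoc C, ENNReal.mul_inv_cancel hC0 hC, one_mul]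
    · rw [ENNReal.mul_rpow_of_nonneg _ _ (by linarith), ← ENNReal.rpow_mul,
        ENNReal.mul_rpow_of_ne_top hc hC, neg_mul, hp1, ENNReal.inv_rpow,
        ENNReal.rpow_add _ _ hC0 hC, ENNReal.rpow_one, ENNReal.mul_inv (Or.inl hC0) (Or.inl hC),
        ENNReal.rpow_neg C, mul_assoc, ← mul_assoc C, ← mul_assoc C,
        ENNReal.mul_inv_cancel hC0 hC, one_mul, mul_comm (C ^ δ)⁻¹]
  have H := ENNReal.inner_le_weight_mul_Lp_of_nonneg (Finset.univ : Finset (Fin 2))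
    (p := 1 + δ) (by linarith) ![u * A, v * B] ![A⁻¹ * a ^ (-γ⁻¹), B⁻¹ * b ^ (-γ⁻¹)]
  simp only [Fin.sum_univ_two, Matrix.cons_val_zero, Matrix.cons_val_one] at H
  rw [(term ha0 ha hA0 hA).1, (term hb0 hb hB0 hB).1, (term ha0 ha hA0 hA).2,
    (term hb0 hb hB0 hB).2, hp2] at H
  have H2 := ENNReal.rpow_le_rpow H hγ0.le
  rw [ENNReal.mul_rpow_of_nonneg _ _ hγ0.le, ← ENNReal.rpow_mul, ← ENNReal.rpow_mul, hp3,
    inv_mul_cancel₀ hγ0.ne', ENNReal.rpow_one] at H2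
  have hneg : ∀ c : ℝ≥0∞, c ≠ 0 → c ^ (-γ⁻¹) ≠ ⊤ := by
    intro c hc
    rw [ENNReal.rpow_neg]
    simp [hc, hγ0, hγ0.le]
  have hX : (u * a ^ (-γ⁻¹) + v * b ^ (-γ⁻¹)) ^ γ ≠ ⊤ :=
    ENNReal.rpow_ne_top_of_nonneg hγ0.le (ENNReal.add_ne_top.2
      ⟨ENNReal.mul_ne_top (by simp) (hneg a ha0), ENNReal.mul_ne_top (by simp) (hneg b hb0)⟩)
  have hX0 : (u * a ^ (-γ⁻¹) + v * b ^ (-γ⁻¹)) ^ γ ≠ 0 := by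
    rw [Ne, ENNReal.rpow_eq_zero_iff_of_pos hγ0, add_eq_zero, not_and_or]
    left
    rw [mul_eq_zero, not_or, ENNReal.rpow_neg, ENNReal.inv_eq_zero]
    exact ⟨hu', ENNReal.rpow_ne_top_of_nonneg (by positivity) ha⟩
  rw [powMean, powMean, ← hδ, ENNReal.rpow_neg _ (γ - 1), ENNReal.rpow_neg _ γ, mul_comm _⁻¹ (_ + _),
    ← div_eq_mul_inv, ENNReal.le_div_iff_mul_le (Or.inl hX0) (Or.inl hX)]
  refine (mul_le_mul_right H2 _).trans ?_
  rw [mul_left_comm]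
  exact mul_le_of_le_one_right (by simp) (ENNReal.inv_mul_le_one _)

/-! ### One-dimensional Brunn–Minkowski and Borell–Brascamp–Lieb inequalities -/

theorem IsCompact.volume_add_le_of_combo_subset {u v : ℝ≥0} {K L D : Set ℝ} (hK : IsCompact K)
    (hL : IsCompact L) (hKn : K.Nonempty) (hLn : L.Nonempty)
    (hD : ∀ x ∈ K, ∀ y ∈ L, (u : ℝ) * x + v * y ∈ D) :
    u * volume K + v * volume L ≤ volume D := by
  obtain ⟨a, haK, ha⟩ := hK.exists_isGreatest hKn
  obtain ⟨b, hbL, hb⟩ := hL.exists_isLeast hLn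
  have vol : ∀ (w : ℝ≥0) (c : ℝ) (S : Set ℝ),
      volume ((fun x => (w : ℝ) * x + c) '' S) = w * volume S := by
    intro w c S
    have h1 : (fun x => (w : ℝ) * x + c) '' S =
        (fun x => x + c) '' ((fun x => (w : ℝ) * x) '' S) := by
      rw [Set.image_image]
    rw [h1, Set.image_add_right, measure_preimage_add_right]
    have := Measure.addHaar_smul volume (w : ℝ) S
    rw [← Set.image_smul] at this
    simpa using this
  have c1 : IsCompact ((fun x => (u : ℝ) * x + v * b) '' K) := hK.image (by fun_prop)
  have c2 : IsCompact ((fun x => (v : ℝ) * x + u * a) '' L) := hL.image (by fun_prop)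
  rw [← vol u (v * b) K, ← vol v (u * a) L]
  -- The two translates meet only at the point `u a + v b`.
  rw [← measure_union₀ c2.measurableSet.nullMeasurableSet]
  · apply measure_mono
    rintro z (⟨x, hx, rfl⟩ | ⟨y, hy, rfl⟩)
    · exact hD x hx b hbL
    · have := hD a haK y hy
      rwa [add_comm] at this
  · refine measure_mono_null (t := {(u : ℝ) * a + v * b}) ?_ (by simp)
    rintro z ⟨⟨x, hx, rfl⟩, ⟨y, hy, h⟩⟩
    have h1 := mul_le_mul_of_nonneg_left (ha hx) u.coe_nonneg
    have h2 := mul_le_mul_of_nonneg_left (hb hy) v.coe_nonneg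
    simp only [Set.mem_singleton_iff] at h ⊢
    linarith

/-- The one-dimensional Brunn–Minkowski inequality. -/
theorem volume_add_le_of_combo_subset {u v : ℝ≥0} {P Q D : Set ℝ} (hP : MeasurableSet P)
    (hQ : MeasurableSet Q) (hPn : P.Nonempty) (hQn : Q.Nonempty)
    (hD : ∀ x ∈ P, ∀ y ∈ Q, (u : ℝ) * x + v * y ∈ D) :
    u * volume P + v * volume Q ≤ volume D := by
  obtain ⟨p, hp⟩ := hPn
  obtain ⟨q, hq⟩ := hQn
  have inner : ∀ S : Set ℝ, MeasurableSet S →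
      volume S = ⨆ (K : Set ℝ) (_ : K ⊆ S ∧ IsCompact K), volume K := by
    intro S hS
    rw [hS.measure_eq_iSup_isCompact]
    simp only [iSup_and]
  rw [inner P hP, inner Q hQ]
  simp only [ENNReal.mul_iSup]
  refine ENNReal.biSup_add_biSup_le' ⟨∅, by simp⟩ ⟨∅, by simp⟩ ?_
  rintro K ⟨hKP, hK⟩ L ⟨hLQ, hL⟩
  refine le_trans ?_ (IsCompact.volume_add_le_of_combo_subset (u := u) (v := v) (hK.insert p)
    (hL.insert q) ⟨p, by simp⟩ ⟨q, by simp⟩ fun x hx y hy =>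
      hD x (Set.insert_subset hp hKP hx) y (Set.insert_subset hq hLQ hy))
  gcongr <;> exact Set.subset_insert _ _

/-- If `F` and `G` have supremum `1`, the superlevel sets of `H` contain the Minkowski combinations
of those of `F` and `G`, and the layer cake formula integrates the Brunn–Minkowski inequality. -/
theorem lintegral_add_le_of_min_le {u v : ℝ≥0} {F G H : ℝ → ℝ≥0∞} (hF : Measurable F)
    (hG : Measurable G) (hH : Measurable H) (hF1 : ∀ x, F x ≤ 1) (hG1 : ∀ x, G x ≤ 1)
    (hFs : ∀ s < 1, ∃ x, s < F x) (hGs : ∀ s < 1, ∃ x, s < G x)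
    (h : ∀ x y : ℝ, min (F x) (G y) ≤ H (u * x + v * y)) :
    u * (∫⁻ x, F x) + v * (∫⁻ x, G x) ≤ ∫⁻ x, H x := by
  have layer : ∀ f : ℝ → ℝ≥0∞, Measurable f → (∀ x, f x ≤ 1) →
      lintegral volume f = ∫⁻ s in Set.Ioi (0 : ℝ), volume {x | ENNReal.ofReal s < f x} := by
    intro f hf hf1
    have hfin : ∀ x, f x ≠ ⊤ := fun x => ne_top_of_le_ne_top (by simp) (hf1 x)
    have := lintegral_eq_lintegral_meas_lt (f := fun x => (f x).toReal) volume
      (Filter.Eventually.of_forall fun x => ENNReal.toReal_nonneg)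
      hf.ennreal_toReal.aemeasurable
    rw [show f = fun x => ENNReal.ofReal (f x).toReal from
      funext fun x => (ENNReal.ofReal_toReal (hfin x)).symm, this]
    refine setLIntegral_congr_fun measurableSet_Ioi fun s hs => ?_
    simp only [ENNReal.ofReal_toReal (hfin _)]
    congr 1
    ext x
    exact (ENNReal.ofReal_lt_iff_lt_toReal (le_of_lt hs) (hfin x)).symm
  calc u * (∫⁻ x, F x) + v * (∫⁻ x, G x)
      = (∫⁻ s in Set.Ioi (0 : ℝ), u * volume {x | ENNReal.ofReal s < F x}) +
        ∫⁻ s in Set.Ioi (0 : ℝ), v * volume {x | ENNReal.ofReal s < G x} := by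
        rw [layer F hF hF1, layer G hG hG1, lintegral_const_mul' _ _ (by simp),
          lintegral_const_mul' _ _ (by simp)]
    _ ≤ ∫⁻ s in Set.Ioi (0 : ℝ), (u * volume {x | ENNReal.ofReal s < F x} +
          v * volume {x | ENNReal.ofReal s < G x}) := le_lintegral_add _ _
    _ ≤ ∫⁻ s in Set.Ioi (0 : ℝ), volume {x | ENNReal.ofReal s < min (H x) 1} := by
        refine lintegral_mono fun s => ?_
        rcases lt_or_ge (ENNReal.ofReal s) 1 with hs | hs
        · refine volume_add_le_of_combo_subset (measurableSet_lt measurable_const hF)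
            (measurableSet_lt measurable_const hG) (hFs _ hs) (hGs _ hs) fun x hx y hy => ?_
          exact lt_min ((lt_min hx hy).trans_le (h x y)) hs
        · have hF0 : {x | ENNReal.ofReal s < F x} = ∅ := by
            ext x; simpa using (hF1 x).trans hs
          have hG0 : {x | ENNReal.ofReal s < G x} = ∅ := by
            ext x; simpa using (hG1 x).trans hs
          simp [hF0, hG0]
    _ = ∫⁻ x, min (H x) 1 := (layer _ (hH.min measurable_const) fun x => min_le_right _ _).symm
    _ ≤ ∫⁻ x, H x := lintegral_mono fun x => min_le_left _ _

/-- The one-dimensional Borell–Brascamp–Lieb inequality for bounded functions: after normalising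
`f` and `g` to have supremum `1`, the means of order `-1/γ` reduce to minima, and Hölder's inequality
undoes the normalisation at the cost of lowering `γ` by `1`. -/
theorem powMean_lintegral_le_real_of_bounded {γ : ℝ} (hγ : 1 < γ) {u v : ℝ≥0} (hu : 0 < u)
    (hv : 0 < v) (huv : u + v = 1) {f g h : ℝ → ℝ≥0∞} (hf : Measurable f) (hg : Measurable g)
    (hh : Measurable h) {k : ℝ≥0∞} (hk : k ≠ ⊤) (hfk : ∀ x, f x ≤ k) (hgk : ∀ x, g x ≤ k)
    (hfgh : ∀ x y : ℝ, powMean γ u v (f x) (g y) ≤ h (u * x + v * y)) :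
    powMean (γ - 1) u v (∫⁻ x, f x) (∫⁻ x, g x) ≤ ∫⁻ x, h x := by
  have hγ0 : 0 < γ := by linarith
  have hγ1 : 0 < γ - 1 := by linarith
  set a := ⨆ x, f x with ha_def
  set b := ⨆ x, g x with hb_def
  have hfa : ∀ x, f x ≤ a := le_iSup f
  have hgb : ∀ x, g x ≤ b := le_iSup g
  have ha : a ≠ ⊤ := ne_top_of_le_ne_top hk (iSup_le hfk)
  have hb : b ≠ ⊤ := ne_top_of_le_ne_top hk (iSup_le hgk)
  rcases eq_or_ne a 0 with ha0 | ha0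
  · have : ∀ x, f x = 0 := fun x => le_antisymm (ha0 ▸ hfa x) bot_le
    simp [this, powMean_zero_left hγ1 hu]
  rcases eq_or_ne b 0 with hb0 | hb0
  · have : ∀ x, g x = 0 := fun x => le_antisymm (hb0 ▸ hgb x) bot_le
    simp [this, powMean_zero_right hγ1 u hv]
  set M := powMean γ u v a b with hM_def
  have hM0 : M ≠ 0 := powMean_ne_zero hγ0 u v ha0 hb0
  have hM : M ≠ ⊤ := powMean_ne_top hγ0 huv ha hb
  have sup_div : ∀ {c : ℝ≥0∞} {φ : ℝ → ℝ≥0∞}, c = ⨆ x, φ x → c ≠ 0 → c ≠ ⊤ → ∀ s < 1,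
      ∃ x, s < c⁻¹ * φ x := by
    intro c φ hcφ hc0 hc s hs
    have : s * c < ⨆ x, φ x := by
      rw [← hcφ]
      calc s * c < 1 * c := by
            rw [ENNReal.mul_lt_mul_iff_left hc0 hc]; exact hs
        _ = c := one_mul c
    obtain ⟨x, hx⟩ := lt_iSup_iff.1 this
    refine ⟨x, ?_⟩
    rw [mul_comm c⁻¹, ← div_eq_mul_inv]
    exact (ENNReal.lt_div_iff_mul_lt (Or.inl hc0) (Or.inl hc)).2 hx
  have hle : ∀ {c z : ℝ≥0∞}, c ≠ 0 → c ≠ ⊤ → z ≤ c → c⁻¹ * z ≤ 1 := by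
    intro c z hc0 hc hz
    exact (ENNReal.inv_mul_le_iff hc0 hc).2 (by simpa using hz)
  have key := lintegral_add_le_of_min_le (u := u) (v := v) (F := fun x => a⁻¹ * f x)
    (G := fun x => b⁻¹ * g x) (H := fun x => M⁻¹ * h x) (hf.const_mul _) (hg.const_mul _)
    (hh.const_mul _) (fun x => hle ha0 ha (hfa x)) (fun x => hle hb0 hb (hgb x))
    (sup_div ha_def ha0 ha) (sup_div hb_def hb0 hb) (by
      intro x y
      set s := min (a⁻¹ * f x) (b⁻¹ * g y) with hs
      rcases eq_or_ne s 0 with hs0 | hs0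
      · rw [hs0]; exact bot_le
      have hs1 : s ≠ ⊤ :=
        ne_top_of_le_ne_top ENNReal.one_ne_top ((min_le_left _ _).trans (hle ha0 ha (hfa x)))
      have h1 : s * a ≤ f x := by
        calc s * a ≤ a⁻¹ * f x * a := by gcongr; exact min_le_left _ _
          _ = a⁻¹ * a * f x := by ring
          _ = f x := by rw [ENNReal.inv_mul_cancel ha0 ha, one_mul]
      have h2 : s * b ≤ g y := by
        calc s * b ≤ b⁻¹ * g y * b := by gcongr; exact min_le_right _ _
          _ = b⁻¹ * b * g y := by ring
          _ = g y := by rw [ENNReal.inv_mul_cancel hb0 hb, one_mul]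
      have h3 : s * M ≤ h (u * x + v * y) := by
        rw [hM_def, ← powMean_smul hγ0 u v a b hs0 hs1]
        exact (powMean_mono hγ0 u v h1 h2).trans (hfgh x y)
      rw [mul_comm M⁻¹, ← div_eq_mul_inv]
      exact (ENNReal.le_div_iff_mul_le (Or.inl hM0) (Or.inl hM)).2 h3)
  rw [lintegral_const_mul _ hf, lintegral_const_mul _ hg, lintegral_const_mul _ hh] at key
  calc powMean (γ - 1) u v (∫⁻ x, f x) (∫⁻ x, g x)
      = powMean (γ - 1) u v (a * (a⁻¹ * ∫⁻ x, f x)) (b * (b⁻¹ * ∫⁻ x, g x)) := by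
        rw [← mul_assoc, ← mul_assoc, ENNReal.mul_inv_cancel ha0 ha,
          ENNReal.mul_inv_cancel hb0 hb, one_mul, one_mul]
    _ ≤ M * (u * (a⁻¹ * ∫⁻ x, f x) + v * (b⁻¹ * ∫⁻ x, g x)) :=
        powMean_mul_le hγ hu hv ha0 hb0 ha hb _ _
    _ ≤ M * (M⁻¹ * ∫⁻ x, h x) := by gcongr
    _ = ∫⁻ x, h x := by rw [← mul_assoc, ENNReal.mul_inv_cancel hM0 hM, one_mul]

theorem powMean_lintegral_le_real {γ : ℝ} (hγ : 1 < γ) {u v : ℝ≥0} (hu : 0 < u)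
    (hv : 0 < v) (huv : u + v = 1) {f g h : ℝ → ℝ≥0∞} (hf : Measurable f) (hg : Measurable g)
    (hh : Measurable h)
    (hfgh : ∀ x y : ℝ, powMean γ u v (f x) (g y) ≤ h (u * x + v * y)) :
    powMean (γ - 1) u v (∫⁻ x, f x) (∫⁻ x, g x) ≤ ∫⁻ x, h x := by
  have conv : ∀ φ : ℝ → ℝ≥0∞, Measurable φ →
      Filter.Tendsto (fun k : ℕ => ∫⁻ x, min (φ x) k) Filter.atTop (nhds (∫⁻ x, φ x)) := by
    intro φ hφ
    refine lintegral_tendsto_of_tendsto_of_monotone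
      (fun k => (hφ.min measurable_const).aemeasurable)
      (Filter.Eventually.of_forall fun x k l hkl => ?_) (Filter.Eventually.of_forall fun x => ?_)
    · exact min_le_min_left _ (by exact_mod_cast hkl)
    · have := (tendsto_const_nhds (x := φ x)).min ENNReal.tendsto_nat_nhds_top
      simpa using this
  refine le_of_tendsto (powMean_tendsto (γ - 1) u v (conv f hf) (conv g hg))
    (Filter.Eventually.of_forall fun k => ?_)
  exact powMean_lintegral_le_real_of_bounded hγ hu hv huv (hf.min measurable_const)
    (hg.min measurable_const) hh (k := k) (by simp) (fun x => min_le_right _ _)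
    (fun x => min_le_right _ _) fun x y =>
      (powMean_mono (by linarith) u v (min_le_left _ _) (min_le_left _ _)).trans (hfgh x y)

/-! ### The Borell–Brascamp–Lieb inequality -/

/-- Induction on the dimension by Fubini: the integrals over the slices satisfy the hypothesis of the
one-dimensional inequality with `γ - n` in place of `γ`. -/
theorem powMean_lintegral_le_pi {u v : ℝ≥0} (hu : 0 < u) (hv : 0 < v) (huv : u + v = 1) (n : ℕ) :
    ∀ {γ : ℝ}, (n : ℝ) < γ → ∀ {f g h : (Fin n → ℝ) → ℝ≥0∞}, Measurable f → Measurable g →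
      Measurable h →
      (∀ x y, powMean γ u v (f x) (g y) ≤ h ((u : ℝ) • x + (v : ℝ) • y)) →
      powMean (γ - n) u v (∫⁻ x, f x) (∫⁻ x, g x) ≤ ∫⁻ x, h x := by
  induction n with
  | zero =>
    intro γ _ f g h _ _ _ hfgh
    rw [Measure.volume_pi_eq_dirac]
    simp only [lintegral_unique, Nat.cast_zero, sub_zero, measure_univ, mul_one]
    exact (hfgh _ _).trans (le_of_eq (congrArg h (Subsingleton.elim _ _)))
  | succ n ih =>
    intro γ hγ f g h hf hg hh hfgh
    push_cast at hγ
    set e := (MeasurableEquiv.piFinSuccAbove (fun _ : Fin (n + 1) => ℝ) 0).symm with he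
    have he_mp : MeasurePreserving e volume volume :=
      (volume_preserving_piFinSuccAbove (fun _ : Fin (n + 1) => ℝ) 0).symm _
    have fub : ∀ φ : (Fin (n + 1) → ℝ) → ℝ≥0∞, Measurable φ →
        ∫⁻ x, φ x = ∫⁻ s : ℝ, ∫⁻ z : Fin n → ℝ, φ (e (s, z)) := by
      intro φ hφ
      rw [← he_mp.lintegral_comp hφ, Measure.volume_eq_prod,
        lintegral_prod (fun z => φ (e z)) (hφ.comp e.measurable).aemeasurable]
    have meas : ∀ φ : (Fin (n + 1) → ℝ) → ℝ≥0∞, Measurable φ →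
        Measurable fun s : ℝ => ∫⁻ z : Fin n → ℝ, φ (e (s, z)) := fun φ hφ =>
      (hφ.comp e.measurable).lintegral_prod_right'
    have sec : ∀ φ : (Fin (n + 1) → ℝ) → ℝ≥0∞, Measurable φ → ∀ s : ℝ,
        Measurable fun z : Fin n → ℝ => φ (e (s, z)) := fun φ hφ s =>
      (hφ.comp e.measurable).comp measurable_prodMk_left
    have lin : ∀ (s t : ℝ) (z w : Fin n → ℝ),
        e ((u : ℝ) * s + v * t, (u : ℝ) • z + (v : ℝ) • w) =
          (u : ℝ) • e (s, z) + (v : ℝ) • e (t, w) := by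
      intro s t z w
      ext i
      refine Fin.cases ?_ (fun j => ?_) i <;>
        simp [he, MeasurableEquiv.piFinSuccAbove, Fin.insertNthEquiv]
    rw [fub f hf, fub g hg, fub h hh, Nat.cast_succ, ← sub_sub]
    refine powMean_lintegral_le_real (by linarith) hu hv huv (meas f hf) (meas g hg) (meas h hh)
      fun s t => ?_
    refine ih (by linarith) (sec f hf s) (sec g hg t) (sec h hh _) fun z w => ?_
    rw [lin]
    exact hfgh _ _

open scoped Classical in
/-- The Borell–Brascamp–Lieb inequality for means of order `-1/γ` with `γ > n`. Neither `f` nor `g`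
has to be measurable, since a lower Lebesgue integral is attained by a measurable minorant. -/
theorem powMean_lintegral_le {u v : ℝ≥0} (hu : 0 < u) (hv : 0 < v) (huv : u + v = 1) {n : ℕ}
    {γ : ℝ} (hγ : (n : ℝ) < γ) {f g h : EuclideanSpace ℝ (Fin n) → ℝ≥0∞}
    (hh : AEMeasurable h)
    (hfgh : ∀ x y, powMean γ u v (f x) (g y) ≤ h ((u : ℝ) • x + (v : ℝ) • y)) :
    powMean (γ - n) u v (∫⁻ x, f x) (∫⁻ x, g x) ≤ ∫⁻ x, h x := by
  obtain ⟨f', hf', hff', ef⟩ := exists_measurable_le_lintegral_eq volume f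
  obtain ⟨g', hg', hgg', eg⟩ := exists_measurable_le_lintegral_eq volume g
  -- A measurable majorant of `h` with the same integral.
  obtain ⟨h', hh', hhh', eh⟩ : ∃ h' : EuclideanSpace ℝ (Fin n) → ℝ≥0∞, Measurable h' ∧ h ≤ h' ∧
      ∫⁻ x, h x = ∫⁻ x, h' x := by
    set N := toMeasurable volume {x | h x ≠ hh.mk h x} with hN
    have hN0 : volume N = 0 := by
      rw [hN, measure_toMeasurable]; exact hh.ae_eq_mk
    refine ⟨N.piecewise (fun _ => ⊤) (hh.mk h), Measurable.piecewise
      (measurableSet_toMeasurable _ _) measurable_const hh.measurable_mk, fun x => ?_, ?_⟩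
    · by_cases hx : x ∈ N
      · simp [hx]
      · have : h x = hh.mk h x := by
          by_contra hne
          exact hx (subset_toMeasurable _ _ hne)
        simp [hx, this]
    · refine lintegral_congr_ae (hh.ae_eq_mk.trans ?_)
      filter_upwards [compl_mem_ae_iff.2 hN0] with x hx
      have : x ∉ N := hx
      simp [this]
  have mp := PiLp.volume_preserving_toLp (Fin n)
  rw [ef, eg, eh, ← mp.lintegral_comp hf', ← mp.lintegral_comp hg', ← mp.lintegral_comp hh']
  refine powMean_lintegral_le_pi hu hv huv n hγ (hf'.comp mp.measurable) (hg'.comp mp.measurable)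
    (hh'.comp mp.measurable) fun x y => ?_
  refine (powMean_mono (n.cast_nonneg.trans_lt hγ) u v (hff' _) (hgg' _)).trans
    ((hfgh _ _).trans ?_)
  exact hhh' _

/-! ### Measures with density a negative power of a convex function -/

section ConvexPower

variable {n : ℕ} {β : ℝ} {V : EuclideanSpace ℝ (Fin n) → ℝ≥0∞}

theorem ConvexOn.convex_sublevel_ennreal (hV : ConvexOn ℝ≥0 Set.univ V) (c : ℝ≥0∞) :
    Convex ℝ {x | V x ≤ c} := by
  intro x hx y hy a b ha hb hab
  lift a to ℝ≥0 using ha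
  lift b to ℝ≥0 using hb
  have hab' : a + b = 1 := by exact_mod_cast hab
  have h := hV.2 (Set.mem_univ x) (Set.mem_univ y) (zero_le (a := a)) (zero_le (a := b)) hab'
  simp only [NNReal.smul_def] at h
  refine h.trans ?_
  calc (a : ℝ≥0∞) * V x + b * V y ≤ a * c + b * c := by gcongr <;> assumption
    _ = c := by rw [← add_mul, ← ENNReal.coe_add, hab', ENNReal.coe_one, one_mul]

theorem ConvexOn.aemeasurable_ennreal (hV : ConvexOn ℝ≥0 Set.univ V) : AEMeasurable V := by
  have h : NullMeasurable V volume := by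
    refine @measurable_of_Iic _ _ _ _ _ (_) _ _ _ _ fun c => ?_
    exact (hV.convex_sublevel_ennreal c).nullMeasurableSet volume
  exact (aestronglyMeasurable_iff_nullMeasurable_separable.2
    ⟨h, Set.univ, TopologicalSpace.IsSeparable.of_separableSpace _, by simp⟩).aemeasurable

theorem convexPowerMeasure_absolutelyContinuous :
    convexPowerMeasure n β V ≪ volume :=
  withDensity_absolutelyContinuous _ _

/-- Borell's theorem: a measure whose density is the power `-β` of a convex function satisfies a
Brunn–Minkowski inequality of order `-1/(β-n)`. -/
theorem powMean_convexPowerMeasure_le (hβ : (n : ℝ) < β) (hV : ConvexOn ℝ≥0 Set.univ V)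
    {u v : ℝ≥0} (hu : 0 < u) (hv : 0 < v) (huv : u + v = 1)
    {A B D : Set (EuclideanSpace ℝ (Fin n))} (hA : MeasurableSet A) (hB : MeasurableSet B)
    (hD : MeasurableSet D) (h : ∀ x ∈ A, ∀ y ∈ B, (u : ℝ) • x + (v : ℝ) • y ∈ D) :
    powMean (β - n) u v (convexPowerMeasure n β V A) (convexPowerMeasure n β V B) ≤
      convexPowerMeasure n β V D := by
  have hβ0 : 0 < β := n.cast_nonneg.trans_lt hβ
  simp only [convexPowerMeasure, withDensity_apply _ hA, withDensity_apply _ hB,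
    withDensity_apply _ hD, ← lintegral_indicator hA, ← lintegral_indicator hB,
    ← lintegral_indicator hD]
  refine powMean_lintegral_le hu hv huv hβ
    ((hV.aemeasurable_ennreal.pow_const _).indicator hD) fun x y => ?_
  by_cases hx : x ∈ A
  · by_cases hy : y ∈ B
    · have hcancel : ∀ c : ℝ≥0∞, (c ^ (-β)) ^ (-β⁻¹) = c := fun c => by
        rw [← ENNReal.rpow_mul, neg_mul_neg, mul_inv_cancel₀ hβ0.ne', ENNReal.rpow_one]
      rw [Set.indicator_of_mem hx, Set.indicator_of_mem hy, Set.indicator_of_mem (h x hx y hy),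
        powMean, hcancel, hcancel]
      refine ENNReal.rpow_le_rpow_of_nonpos ?_ (by linarith)
      exact hV.2 (Set.mem_univ x) (Set.mem_univ y) (zero_le (a := u)) (zero_le (a := v)) huv
    · rw [Set.indicator_of_notMem hy, powMean_zero_right hβ0 u hv]
      exact zero_le
  · rw [Set.indicator_of_notMem hx, powMean_zero_left hβ0 hu]
    exact zero_le

/-- The mass in a spherical shell is positive if there is mass both inside and outside of it: the
segments joining the two cross the shell within the interior of the convex set `{V < ∞}`. -/
theorem convexPowerMeasure_shell_pos (hβ : 0 < β) (hV0 : ∀ x, 0 < V x)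
    (hV : ConvexOn ℝ≥0 Set.univ V) {r₁ r₂ : ℝ} (hr : r₁ < r₂)
    (h₁ : convexPowerMeasure n β V {x | ‖x‖ ≤ r₁} ≠ 0)
    (h₂ : convexPowerMeasure n β V {x | ‖x‖ ≤ r₂}ᶜ ≠ 0) :
    convexPowerMeasure n β V {x | r₁ < ‖x‖ ∧ ‖x‖ < r₂} ≠ 0 := by
  set K : Set (EuclideanSpace ℝ (Fin n)) := {x | V x ≠ ⊤} with hK
  have hKc : Convex ℝ K := by
    have : K = ⋃ k : ℕ, {x | V x ≤ k} := by
      ext x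
      simp only [hK, Set.mem_ofPred_eq, Set.mem_iUnion]
      refine ⟨fun hx => ?_, fun ⟨k, hk⟩ => ne_top_of_le_ne_top (by simp) hk⟩
      obtain ⟨k, hk⟩ := ENNReal.exists_nat_gt hx
      exact ⟨k, hk.le⟩
    rw [this]
    refine Directed.convex_iUnion (directed_of_isDirected_le fun k l hkl x hx => ?_)
      fun k => hV.convex_sublevel_ennreal k
    exact (show V x ≤ k from hx).trans (by exact_mod_cast hkl)
  have hmeas : AEMeasurable (fun x => V x ^ (-β)) := hV.aemeasurable_ennreal.pow_const _
  have hsupp : {x | V x ^ (-β) ≠ 0} = K := by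
    ext x
    simp only [hK, Set.mem_ofPred_eq, ne_eq, ENNReal.rpow_eq_zero_iff, not_or, not_and]
    refine ⟨fun h hx => h.2 hx (by linarith), fun h => ⟨fun h0 => absurd h0 (hV0 x).ne', ?_⟩⟩
    exact fun h' => absurd h' h
  have zero_iff : ∀ S, convexPowerMeasure n β V S = 0 ↔ volume (K ∩ S) = 0 := fun S => by
    rw [convexPowerMeasure, withDensity_apply_eq_zero' hmeas, hsupp]
  have interior_pt : ∀ S, convexPowerMeasure n β V S ≠ 0 → ∃ x ∈ interior K, x ∈ S := by
    intro S hS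
    by_contra! hcon
    refine hS ((zero_iff S).2 (measure_mono_null (fun x hx => ?_) (hKc.addHaar_frontier volume)))
    exact ⟨subset_closure hx.1, fun hi => hcon x hi hx.2⟩
  obtain ⟨x, hxK, hx⟩ := interior_pt _ h₁
  obtain ⟨y, hyK, hy⟩ := interior_pt _ h₂
  simp only [Set.mem_compl_iff, Set.mem_ofPred_eq, not_le] at hx hy
  obtain ⟨z, hzK, hz⟩ := hKc.interior.isPreconnected.intermediate_value hxK hyK
    continuous_norm.continuousOn (show (r₁ + r₂) / 2 ∈ Set.Icc ‖x‖ ‖y‖ from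
      ⟨by linarith, by linarith⟩)
  have hopen : IsOpen (interior K ∩ {x | r₁ < ‖x‖ ∧ ‖x‖ < r₂}) :=
    isOpen_interior.inter ((isOpen_lt continuous_const continuous_norm).inter
      (isOpen_lt continuous_norm continuous_const))
  rw [Ne, zero_iff]
  intro h0
  refine (hopen.measure_pos volume ⟨z, hzK, ?_⟩).ne'
    (measure_mono_null (Set.inter_subset_inter_left _ interior_subset) h0)
  simp only [Set.mem_ofPred_eq, hz]
  constructor <;> linarith

theorem exists_radius_of_absolutelyContinuous (hn : 1 ≤ n)
    {μ : Measure (EuclideanSpace ℝ (Fin n))} [IsProbabilityMeasure μ] (hμ : μ ≪ volume)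
    {p : ℝ} (hp0 : 0 < p) (hp1 : p < 1) :
    ∃ r : ℝ, 0 < r ∧ μ {x | ‖x‖ ≤ r} = ENNReal.ofReal p := by
  have : Nonempty (Fin n) := ⟨⟨0, hn⟩⟩
  have hm : Measurable (fun x : EuclideanSpace ℝ (Fin n) => ‖x‖) := measurable_norm
  set ν := μ.map (fun x => ‖x‖) with hν
  have : IsProbabilityMeasure ν := Measure.isProbabilityMeasure_map hm.aemeasurable
  have hsphere : ∀ s : ℝ, ν {s} = 0 := by
    intro s
    rw [hν, Measure.map_apply hm (measurableSet_singleton s)]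
    refine hμ ?_
    rw [show (fun x : EuclideanSpace ℝ (Fin n) => ‖x‖) ⁻¹' {s} = Metric.sphere 0 s by
      ext; simp]
    exact Measure.addHaar_sphere volume 0 s
  have hcdf : ∀ s, ENNReal.ofReal (cdf ν s) = μ {x | ‖x‖ ≤ s} := by
    intro s
    rw [ofReal_cdf, hν, Measure.map_apply hm measurableSet_Iic]
    rfl
  have hcont : Continuous (cdf ν) := by
    rw [continuous_iff_continuousAt]
    intro s
    rw [(monotone_cdf ν).continuousAt_iff_leftLim_eq_rightLim, StieltjesFunction.rightLim_eq]
    have h := (cdf ν).measure_singleton s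
    rw [measure_cdf, hsphere, eq_comm, ENNReal.ofReal_eq_zero] at h
    exact le_antisymm ((monotone_cdf ν).leftLim_le le_rfl) (by linarith)
  have h0 : cdf ν 0 = 0 := by
    have : ENNReal.ofReal (cdf ν 0) = 0 := by
      rw [hcdf]
      refine measure_mono_null (t := (fun x => ‖x‖) ⁻¹' {0}) (fun x hx => ?_) ?_
      · exact le_antisymm hx (norm_nonneg x)
      · rw [← Measure.map_apply hm (measurableSet_singleton 0)]; exact hsphere 0
    exact le_antisymm (ENNReal.ofReal_eq_zero.1 this) (cdf_nonneg ν 0)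
  obtain ⟨s, hs⟩ := ((tendsto_cdf_atTop ν).eventually (lt_mem_nhds hp1)).exists
  obtain ⟨r, hr⟩ := mem_range_of_exists_le_of_exists_ge hcont ⟨0, h0.le.trans hp0.le⟩ ⟨s, hs.le⟩
  refine ⟨r, ?_, by rw [← hcdf, hr]⟩
  by_contra! hr0
  have := monotone_cdf ν hr0
  linarith

/-- The derivative at `t = 0` of the power mean with weights `1 - t` and `t`, which is convex
in `t`, bounds the growth of the measure under mixing with a set of measure `2/3`. -/
theorem mul_le_powMean {α : ℝ} (hα : 0 < α) {u v : ℝ≥0} (huv : u + v = 1)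
    {p : ℝ≥0∞} (hp : p ≤ 1 / 2) :
    ENNReal.ofReal (1 + v * (α / (4 * (α + 1)))) * p ≤ powMean α u v p (2 / 3) := by
  rcases eq_or_ne p 0 with rfl | hp0
  · simp
  have hpt : p ≠ ⊤ := ne_top_of_le_ne_top (by simp) hp
  have h43 : p * ENNReal.ofReal (4 / 3) ≤ 2 / 3 := by
    calc p * ENNReal.ofReal (4 / 3) ≤ 1 / 2 * ENNReal.ofReal (4 / 3) := by gcongr
      _ = 2 / 3 := by
        rw [show (1 / 2 : ℝ≥0∞) = ENNReal.ofReal (1 / 2) by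
            rw [ENNReal.ofReal_div_of_pos (by norm_num)]; simp,
          ← ENNReal.ofReal_mul (by norm_num),
          show (1 / 2 * (4 / 3) : ℝ) = 2 / 3 by norm_num,
          ENNReal.ofReal_div_of_pos (by norm_num)]
        simp
  refine le_trans ?_ (powMean_mono hα u v (mul_one p).le h43)
  rw [powMean_smul hα u v _ _ hp0 hpt, mul_comm]
  refine mul_le_mul_right ?_ p
  have hu1 : (u : ℝ) = 1 - v := by
    have : (u : ℝ) + v = 1 := by exact_mod_cast huv
    linarith
  have hv0 : (0 : ℝ) ≤ v := v.coe_nonneg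
  have hv1 : (v : ℝ) ≤ 1 := by have := u.coe_nonneg; linarith
  set τ : ℝ := (4 / 3 : ℝ) ^ (-α⁻¹) with hτ
  have hτ0 : 0 < τ := by positivity
  have hτ1 : τ ≤ 4 * α / (4 * α + 1) := by
    have hlog : (1 / 4 : ℝ) ≤ Real.log (4 / 3) := by
      have := Real.one_sub_inv_le_log_of_pos (show (0 : ℝ) < 4 / 3 by norm_num)
      norm_num at this ⊢
      exact this
    have hexp : 1 + 1 / (4 * α) ≤ (4 / 3 : ℝ) ^ α⁻¹ := by
      rw [Real.rpow_def_of_pos (by norm_num)]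
      have h1 := Real.add_one_le_exp (Real.log (4 / 3) * α⁻¹)
      have h2 : 1 / 4 * α⁻¹ ≤ Real.log (4 / 3) * α⁻¹ :=
        mul_le_mul_of_nonneg_right hlog (by positivity)
      have h3 : 1 / (4 * α) = 1 / 4 * α⁻¹ := by field_simp
      linarith
    rw [hτ, Real.rpow_neg (by norm_num)]
    refine (inv_anti₀ (by positivity) hexp).trans (le_of_eq ?_)
    field_simp
  have hθ : 1 / (4 * α + 1) ≤ 1 - τ := by
    have : 4 * α / (4 * α + 1) = 1 - 1 / (4 * α + 1) := by field_simp; ring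
    linarith
  have hθ0 : 0 < 1 - τ := lt_of_lt_of_le (by positivity) hθ
  have hpos : 0 < 1 - v * (1 - τ) := by
    have := mul_le_mul_of_nonneg_right hv1 hθ0.le
    linarith
  have hmean : powMean α u v 1 (ENNReal.ofReal (4 / 3)) =
      ENNReal.ofReal ((1 - v * (1 - τ)) ^ (-α)) := by
    rw [powMean, ENNReal.one_rpow, ENNReal.ofReal_rpow_of_pos (by norm_num), ← hτ,
      ← ENNReal.ofReal_rpow_of_pos hpos, mul_one, ← ENNReal.ofReal_coe_nnreal (p := u),
      ← ENNReal.ofReal_coe_nnreal (p := v), ← ENNReal.ofReal_mul hv0,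
      ← ENNReal.ofReal_add u.coe_nonneg (by positivity), hu1]
    congr 2
    ring
  rw [hmean]
  refine ENNReal.ofReal_le_ofReal ?_
  have hαθ : α / (4 * (α + 1)) ≤ α * (1 - τ) := by
    calc α / (4 * (α + 1)) ≤ α * (1 / (4 * α + 1)) := by
          rw [mul_one_div]
          exact div_le_div_of_nonneg_left hα.le (by positivity) (by linarith)
      _ ≤ α * (1 - τ) := by gcongr
  have hlog : Real.log (1 - v * (1 - τ)) ≤ -(v * (1 - τ)) := by
    have := Real.log_le_sub_one_of_pos hpos
    linarith
  rw [Real.rpow_def_of_pos hpos]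
  have h1 := Real.add_one_le_exp (Real.log (1 - v * (1 - τ)) * -α)
  have h2 : v * (α / (4 * (α + 1))) ≤ v * (α * (1 - τ)) := mul_le_mul_of_nonneg_left hαθ hv0
  nlinarith

end ConvexPower

/-! ### From expansion of sets to a weighted `L¹` inequality -/

section Weighted

variable {E : Type*} [NormedAddCommGroup E] [MeasurableSpace E] {μ : Measure E} {r c : ℝ}

/-- A weighted Cheeger inequality from expansion: if mixing a set of measure at most `1/2` with the
ball of radius `r` enlarges its measure at rate `c`, then integrating over the superlevel sets of
`f` bounds `∫ f`. Mixing at time `t` moves a point to `y` over a distance at most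
`t / (1 - t) * (r + ‖y‖)`, which is where the weight `r + ‖y‖` comes from. -/
theorem mul_integral_le_of_expansion [NormedSpace ℝ E] [BorelSpace E] [IsProbabilityMeasure μ]
    (hr : 0 ≤ r) (hc : 0 ≤ c)
    (hμ : ∀ t : ℝ, 0 < t → t < 1 → ∀ A D : Set E, MeasurableSet A → MeasurableSet D →
      μ A ≤ 1 / 2 → (∀ x ∈ A, ∀ b : E, ‖b‖ ≤ r → (1 - t) • x + t • b ∈ D) →
      ENNReal.ofReal (1 + t * c) * μ A ≤ μ D)
    {f : E → ℝ} (hf : ContDiff ℝ 1 f) (hfc : HasCompactSupport f) (hf0 : ∀ x, 0 ≤ f x)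
    (hfm : μ {x | 0 < f x} ≤ 1 / 2) :
    c * ∫ x, f x ∂μ ≤ ∫ x, ‖fderiv ℝ f x‖ * (r + ‖x‖) ∂μ := by
  have hDc : Continuous (fderiv ℝ f) := hf.continuous_fderiv one_ne_zero
  have hDs : HasCompactSupport (fderiv ℝ f) := hfc.fderiv ℝ
  have hfi : Integrable f μ := hf.continuous.integrable_of_hasCompactSupport hfc
  have hGi : Integrable (fun x => ‖fderiv ℝ f x‖ * (r + ‖x‖)) μ :=
    Continuous.integrable_of_hasCompactSupport (by fun_prop) hDs.norm.mul_right
  obtain ⟨R, hR0, hR⟩ : ∃ R : ℝ, 0 ≤ R ∧ ∀ x, f x ≠ 0 → ‖x‖ ≤ R := by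
    obtain ⟨R, hR⟩ := hfc.isCompact.isBounded.exists_norm_le
    exact ⟨max R 0, le_max_right _ _, fun x hx =>
      (hR x (subset_tsupport f hx)).trans (le_max_left _ _)⟩
  have key : ∀ ε > 0, c * ∫ x, f x ∂μ ≤
      (∫ x, ‖fderiv ℝ f x‖ * (r + ‖x‖) ∂μ) + ε * (2 * r + R) := by
    intro ε hε
    obtain ⟨δ, hδ, hδε⟩ := Metric.uniformContinuous_iff.1
      (hDs.uniformContinuous_of_continuous hDc) ε hε
    set W : E → ℝ := fun y => ‖fderiv ℝ f y‖ * (r + ‖y‖) + ε * (2 * r + R) with hW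
    have hW0 : ∀ y, 0 ≤ W y := fun y => by positivity
    have hWi : Integrable W μ := hGi.add (integrable_const _)
    have hWm : Measurable W := by
      have : Continuous W := by fun_prop
      exact this.measurable
    have hWint : ∫ y, W y ∂μ = (∫ x, ‖fderiv ℝ f x‖ * (r + ‖x‖) ∂μ) + ε * (2 * r + R) := by
      rw [hW, integral_add hGi (integrable_const _)]
      simp
    rw [← hWint]
    have small : ∀ t : ℝ, 0 < t → t < 1 → t * (R + r) < δ →
        c * (1 - t) * ∫ x, f x ∂μ ≤ ∫ y, W y ∂μ := by
      intro t ht0 ht1 htδ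
      have h1t : 0 < 1 - t := by linarith
      have ptw : ∀ x b : E, ‖b‖ ≤ r →
          f x ≤ f ((1 - t) • x + t • b) + t / (1 - t) * W ((1 - t) • x + t • b) := by
        intro x b hb
        set y := (1 - t) • x + t • b with hy
        by_cases hx : f x = 0
        · rw [hx]
          have := hW0 y
          have := hf0 y
          positivity
        have hxR := hR x hx
        have hxy : x - y = t • (x - b) := by rw [hy]; module
        have hyb : (1 - t) • (x - b) = y - b := by rw [hy]; module
        have hdist : ‖x - y‖ ≤ t / (1 - t) * (r + ‖y‖) := by
          have h1 : ‖x - b‖ = ‖y - b‖ / (1 - t) := by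
            rw [← hyb, norm_smul, Real.norm_of_nonneg h1t.le]; field_simp
          rw [hxy, norm_smul, Real.norm_of_nonneg ht0.le, h1, ← mul_div_assoc,
            mul_div_right_comm]
          gcongr
          exact (norm_sub_le _ _).trans (by linarith)
        have hdist' : ‖x - y‖ < δ := by
          rw [hxy, norm_smul, Real.norm_of_nonneg ht0.le]
          refine lt_of_le_of_lt ?_ htδ
          gcongr
          exact (norm_sub_le _ _).trans (by linarith)
        have hyR : ‖y‖ ≤ R + r := by
          calc ‖y‖ ≤ ‖(1 - t) • x‖ + ‖t • b‖ := norm_add_le _ _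
            _ = (1 - t) * ‖x‖ + t * ‖b‖ := by
              rw [norm_smul, norm_smul, Real.norm_of_nonneg h1t.le, Real.norm_of_nonneg ht0.le]
            _ ≤ 1 * R + 1 * r := by gcongr; linarith
            _ = R + r := by ring
        have hmv : ‖f x - f y‖ ≤ (‖fderiv ℝ f y‖ + ε) * ‖x - y‖ := by
          refine Convex.norm_image_sub_le_of_norm_fderiv_le (𝕜 := ℝ) (s := Metric.ball y δ)
            (fun z _ => (hf.differentiable one_ne_zero) z) (fun z hz => ?_) (convex_ball y δ)
            (Metric.mem_ball_self hδ) (by rwa [mem_ball_iff_norm])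
          have h1 := hδε (Metric.mem_ball.1 hz)
          rw [dist_eq_norm] at h1
          have h2 := norm_sub_norm_le (fderiv ℝ f z) (fderiv ℝ f y)
          linarith
        have hfin : f x - f y ≤ t / (1 - t) * W y := by
          calc f x - f y ≤ ‖f x - f y‖ := Real.le_norm_self _
            _ ≤ (‖fderiv ℝ f y‖ + ε) * (t / (1 - t) * (r + ‖y‖)) :=
              hmv.trans (by gcongr)
            _ = t / (1 - t) * (‖fderiv ℝ f y‖ * (r + ‖y‖) + ε * (r + ‖y‖)) := by ring
            _ ≤ t / (1 - t) * W y := by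
              refine mul_le_mul_of_nonneg_left ?_ (by positivity)
              exact add_le_add_right (mul_le_mul_of_nonneg_left (by linarith) hε.le) _
        linarith
      have hhi : Integrable (fun y => f y + t / (1 - t) * W y) μ := hfi.add (hWi.const_mul _)
      have hh0 : ∀ y, 0 ≤ f y + t / (1 - t) * W y := fun y => by
        have := hW0 y
        have := hf0 y
        positivity
      have layer : ENNReal.ofReal (1 + t * c) * ∫⁻ x, ENNReal.ofReal (f x) ∂μ ≤
          ∫⁻ y, ENNReal.ofReal (f y + t / (1 - t) * W y) ∂μ := by
        rw [lintegral_eq_lintegral_meas_lt μ (Filter.Eventually.of_forall hf0)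
            hf.continuous.measurable.aemeasurable,
          lintegral_eq_lintegral_meas_lt μ (Filter.Eventually.of_forall hh0)
            hhi.aestronglyMeasurable.aemeasurable, ← lintegral_const_mul' _ _ (by simp)]
        refine setLIntegral_mono' measurableSet_Ioi fun s hs => ?_
        refine hμ t ht0 ht1 _ _ (measurableSet_lt measurable_const hf.continuous.measurable)
          (measurableSet_lt measurable_const
            (hf.continuous.measurable.add (hWm.const_mul _))) ?_ fun x hx b hb => ?_
        · exact (measure_mono fun x (hx : s < f x) => lt_trans hs hx).trans hfm
        · exact lt_of_lt_of_le hx (ptw x b hb)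
      rw [← ofReal_integral_eq_lintegral_ofReal hfi (Filter.Eventually.of_forall hf0),
        ← ofReal_integral_eq_lintegral_ofReal hhi (Filter.Eventually.of_forall hh0),
        ← ENNReal.ofReal_mul (by positivity),
        ENNReal.ofReal_le_ofReal_iff (integral_nonneg hh0),
        integral_add hfi (hWi.const_mul _), integral_const_mul] at layer
      have h3 : t * (c * ∫ x, f x ∂μ) ≤ t * ((∫ y, W y ∂μ) / (1 - t)) := by
        have : t / (1 - t) * ∫ y, W y ∂μ = t * ((∫ y, W y ∂μ) / (1 - t)) := by ring
        linarith
      have h4 := le_of_mul_le_mul_left h3 ht0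
      rw [le_div_iff₀ h1t] at h4
      linarith
    have hlim : Filter.Tendsto (fun t : ℝ => c * (1 - t) * ∫ x, f x ∂μ)
        (nhdsWithin 0 (Set.Ioi 0)) (nhds (c * ∫ x, f x ∂μ)) := by
      have : Continuous fun t : ℝ => c * (1 - t) * ∫ x, f x ∂μ := by fun_prop
      have h := this.tendsto 0
      simp only [sub_zero, mul_one] at h
      exact h.mono_left nhdsWithin_le_nhds
    refine le_of_tendsto hlim ?_
    have hδlim : Filter.Tendsto (fun t : ℝ => t * (R + r)) (nhdsWithin 0 (Set.Ioi 0))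
        (nhds 0) := by
      have : Continuous fun t : ℝ => t * (R + r) := by fun_prop
      have h := this.tendsto 0
      simp only [zero_mul] at h
      exact h.mono_left nhdsWithin_le_nhds
    filter_upwards [self_mem_nhdsWithin, hδlim.eventually (gt_mem_nhds hδ),
      (Filter.Tendsto.mono_left Filter.tendsto_id nhdsWithin_le_nhds).eventually
        (gt_mem_nhds (show (0 : ℝ) < 1 by norm_num))] with t ht0 htδ ht1
    exact small t ht0 ht1 htδ
  refine le_of_forall_pos_le_add fun ε hε => ?_
  have hpos : 0 < 2 * r + R + 1 := by positivity
  refine (key (ε / (2 * r + R + 1)) (by positivity)).trans ?_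
  gcongr
  rw [div_mul_eq_mul_div, div_le_iff₀ hpos]
  nlinarith

/-! ### The weighted `L²` inequality for positive parts -/

/-- Smooth cutoffs at scale `k`, whose gradients are bounded by a multiple of `1 / (1 + ‖x‖)`
uniformly in `k`. -/
theorem exists_cutoff (E : Type*) [NormedAddCommGroup E] [InnerProductSpace ℝ E]
    [FiniteDimensional ℝ E] :
    ∃ K : ℝ, ∀ k : ℕ, 1 ≤ k → ∃ χ : E → ℝ, ContDiff ℝ 1 χ ∧ HasCompactSupport χ ∧
      (∀ x, 0 ≤ χ x) ∧ (∀ x, χ x ≤ 1) ∧ (∀ x, ‖x‖ < k → χ x = 1) ∧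
      ∀ x, ‖fderiv ℝ χ x‖ * (1 + ‖x‖) ≤ K := by
  let B : ContDiffBump (0 : E) := ⟨1, 2, one_pos, one_lt_two⟩
  have hB : ContDiff ℝ 1 B := B.contDiff
  obtain ⟨K, hK⟩ : ∃ K, ∀ x, ‖‖fderiv ℝ B x‖ * (1 + ‖x‖)‖ ≤ K := by
    have hD := hB.continuous_fderiv one_ne_zero
    exact HasCompactSupport.exists_bound_of_continuous
      (B.hasCompactSupport.fderiv ℝ).norm.mul_right (by fun_prop)
  refine ⟨K, fun k hk => ⟨fun x => B ((k : ℝ)⁻¹ • x), ?_, ?_, fun x => B.nonneg,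
    fun x => B.le_one, fun x hx => ?_, fun x => ?_⟩⟩
  · exact hB.comp (contDiff_const_smul _)
  · exact B.hasCompactSupport.comp_smul (by positivity)
  · refine B.one_of_mem_closedBall ?_
    have hk0 : (0 : ℝ) < k := by exact_mod_cast hk
    rw [mem_closedBall_zero_iff, norm_smul, norm_inv, Real.norm_natCast, inv_mul_le_iff₀ hk0]
    simpa [B] using hx.le
  · have hk1 : (1 : ℝ) ≤ k := by exact_mod_cast hk
    have hk0 : (0 : ℝ) < k := by linarith
    have h1 := (Real.le_norm_self _).trans (hK ((k : ℝ)⁻¹ • x))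
    rw [fderiv_comp_smul, norm_smul, norm_inv, Real.norm_natCast]
    refine le_trans ?_ h1
    rw [norm_smul, norm_inv, Real.norm_natCast]
    have h2 : (k : ℝ)⁻¹ ≤ 1 := inv_le_one_of_one_le₀ hk1
    have h3 := norm_nonneg (fderiv ℝ B ((k : ℝ)⁻¹ • x))
    have h4 := norm_nonneg x
    calc (k : ℝ)⁻¹ * ‖fderiv ℝ B ((k : ℝ)⁻¹ • x)‖ * (1 + ‖x‖)
        = ‖fderiv ℝ B ((k : ℝ)⁻¹ • x)‖ * ((k : ℝ)⁻¹ + (k : ℝ)⁻¹ * ‖x‖) := by ring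
      _ ≤ _ := by gcongr

theorem hasDerivAt_posPart_sq (s : ℝ) :
    HasDerivAt (fun s : ℝ => max s 0 ^ 2) (2 * max s 0) s := by
  rcases lt_trichotomy s 0 with hs | rfl | hs
  · rw [max_eq_right hs.le, mul_zero]
    refine (hasDerivAt_const s (0 : ℝ)).congr_of_eventuallyEq ?_
    filter_upwards [gt_mem_nhds hs] with x hx
    simp [max_eq_right hx.le]
  · rw [max_self, mul_zero, hasDerivAt_iff_isLittleO]
    have h : (fun x : ℝ => x ^ 2) =o[nhds 0] fun x => x := by
      simpa using Asymptotics.isLittleO_pow_pow (𝕜 := ℝ) (m := 1) (n := 2) (by norm_num)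
    refine (Asymptotics.IsBigO.of_bound 1 ?_).trans_isLittleO
      (by simpa using h : (fun x : ℝ => x ^ 2) =o[nhds 0] fun x : ℝ => x - 0)
    refine Filter.Eventually.of_forall fun x => ?_
    rcases le_total x 0 with hx | hx
    · simp [max_eq_right hx]; positivity
    · simp [max_eq_left hx]
  · rw [max_eq_left hs.le]
    have h := hasDerivAt_pow 2 s
    simp only [Nat.cast_ofNat, Nat.add_one_sub_one, pow_one] at h
    refine h.congr_of_eventuallyEq ?_
    filter_upwards [lt_mem_nhds hs] with x hx
    simp [max_eq_left hx.le]

/-- The `L¹` inequality applied to `u² χ`, with `u` the positive part of `g - m` and `χ` a cutoff;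
the gradient of `u²` is absorbed by `2ab ≤ (c/2) a² + (2/c) b²`. -/
theorem integral_posPart_sq_le [InnerProductSpace ℝ E] [FiniteDimensional ℝ E] [BorelSpace E]
    [IsProbabilityMeasure μ] (hr : 0 ≤ r) (hc : 0 < c)
    (hμ : ∀ f : E → ℝ, ContDiff ℝ 1 f → HasCompactSupport f → (∀ x, 0 ≤ f x) →
      μ {x | 0 < f x} ≤ 1 / 2 → c * ∫ x, f x ∂μ ≤ ∫ x, ‖fderiv ℝ f x‖ * (r + ‖x‖) ∂μ)
    {g : E → ℝ} (hg : ContDiff ℝ 1 g) {M : ℝ} (hM : ∀ x, |g x| ≤ M) {m : ℝ}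
    (hm : μ {x | m < g x} ≤ 1 / 2)
    (hG : Integrable (fun x => ‖fderiv ℝ g x‖ ^ 2 * (r + ‖x‖) ^ 2) μ) :
    ∫ x, max (g x - m) 0 ^ 2 ∂μ ≤
      4 / c ^ 2 * ∫ x, ‖fderiv ℝ g x‖ ^ 2 * (r + ‖x‖) ^ 2 ∂μ := by
  set u : E → ℝ := fun x => max (g x - m) 0 with hu
  have hu0 : ∀ x, 0 ≤ u x := fun x => le_max_right _ _
  have huc : Continuous u := by have := hg.continuous; fun_prop
  have hub : ∀ x, u x ≤ M + |m| := fun x => by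
    refine max_le ?_ ?_
    · have := hM x
      have := le_abs_self (g x)
      have := neg_abs_le m
      linarith
    · have := (abs_nonneg (g x)).trans (hM x)
      positivity
  have hsq : ContDiff ℝ 1 fun s : ℝ => max s 0 ^ 2 := by
    rw [contDiff_one_iff_deriv]
    refine ⟨fun s => (hasDerivAt_posPart_sq s).differentiableAt, ?_⟩
    rw [show deriv (fun s : ℝ => max s 0 ^ 2) = fun s => 2 * max s 0 from
      funext fun s => (hasDerivAt_posPart_sq s).deriv]
    fun_prop
  have hu2 : ContDiff ℝ 1 fun x => u x ^ 2 := hsq.comp (hg.sub contDiff_const)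
  have hu2d : ∀ x, HasFDerivAt (fun x => u x ^ 2) ((2 * u x) • fderiv ℝ g x) x := fun x =>
    (hasDerivAt_posPart_sq (g x - m)).comp_hasFDerivAt (f := fun x => g x - m) x
      (((hg.differentiable one_ne_zero) x).hasFDerivAt.sub_const m)
  obtain ⟨K, hK⟩ := exists_cutoff E
  choose χ hχ hχc hχ0 hχ1 hχk hχK using fun k : ℕ => hK (k + 1) (by omega)
  set I := ∫ x, ‖fderiv ℝ g x‖ ^ 2 * (r + ‖x‖) ^ 2 ∂μ with hI
  have hDχ : ∀ k, Continuous (fderiv ℝ (χ k)) := fun k => (hχ k).continuous_fderiv one_ne_zero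
  have hi1 : ∀ k, Integrable (fun x => u x ^ 2 * χ k x) μ := fun k =>
    Continuous.integrable_of_hasCompactSupport
      ((huc.pow 2).mul (hχ k).continuous) (hχc k).mul_left
  have hi2 : ∀ k, Integrable (fun x => u x ^ 2 * (‖fderiv ℝ (χ k) x‖ * (r + ‖x‖))) μ := fun k =>
    Continuous.integrable_of_hasCompactSupport
      ((huc.pow 2).mul ((hDχ k).norm.mul (by fun_prop)))
      ((hχc k).fderiv ℝ).norm.mul_right.mul_left
  have step : ∀ k, c * ∫ x, u x ^ 2 * χ k x ∂μ ≤ c / 2 * (∫ x, u x ^ 2 * χ k x ∂μ) + 2 / c * I +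
      ∫ x, u x ^ 2 * (‖fderiv ℝ (χ k) x‖ * (r + ‖x‖)) ∂μ := by
    intro k
    have hfd : ContDiff ℝ 1 fun x => u x ^ 2 * χ k x := hu2.mul (hχ k)
    refine (hμ _ hfd (hχc k).mul_left (fun x => mul_nonneg (sq_nonneg _) (hχ0 k x))
      ((measure_mono fun x hx => ?_).trans hm)).trans ?_
    · by_contra hx'
      have : u x = 0 := max_eq_right (by
        have : ¬ m < g x := hx'
        linarith)
      simp [this] at hx
    · have hsum : Integrable (fun x => c / 2 * (u x ^ 2 * χ k x) +
          2 / c * (‖fderiv ℝ g x‖ ^ 2 * (r + ‖x‖) ^ 2)) μ :=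
        ((hi1 k).const_mul _).add (hG.const_mul _)
      rw [← integral_const_mul, ← integral_const_mul, ← integral_add ((hi1 k).const_mul _)
        (hG.const_mul _), ← integral_add hsum (hi2 k)]
      refine integral_mono (Continuous.integrable_of_hasCompactSupport
        ((hfd.continuous_fderiv one_ne_zero).norm.mul (by fun_prop))
        ((hχc k).mul_left.fderiv ℝ).norm.mul_right)
        (hsum.add (hi2 k)) fun x => ?_
      have hd : fderiv ℝ (fun x => u x ^ 2 * χ k x) x =
          u x ^ 2 • fderiv ℝ (χ k) x + χ k x • ((2 * u x) • fderiv ℝ g x) :=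
        ((hu2d x).mul ((hχ k).differentiable one_ne_zero x).hasFDerivAt).fderiv
      have hw : 0 ≤ r + ‖x‖ := by positivity
      have hn : ‖fderiv ℝ (fun x => u x ^ 2 * χ k x) x‖ ≤
          u x ^ 2 * ‖fderiv ℝ (χ k) x‖ + χ k x * (2 * u x * ‖fderiv ℝ g x‖) := by
        rw [hd]
        refine (norm_add_le _ _).trans (le_of_eq ?_)
        rw [norm_smul, norm_smul, norm_smul, Real.norm_of_nonneg (sq_nonneg _),
          Real.norm_of_nonneg (hχ0 k x), Real.norm_of_nonneg (by have := hu0 x; positivity)]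
      set a := ‖fderiv ℝ g x‖ * (r + ‖x‖) with ha
      have hamgm : 2 * u x * a ≤ c / 2 * u x ^ 2 + 2 / c * a ^ 2 := by
        have h1 : c / 2 * u x ^ 2 + 2 / c * a ^ 2 - 2 * u x * a =
            c / 2 * (u x - 2 / c * a) ^ 2 := by field_simp; ring
        have h2 : 0 ≤ c / 2 * (u x - 2 / c * a) ^ 2 := by positivity
        linarith
      have hχa : χ k x * (2 / c * a ^ 2) ≤ 2 / c * a ^ 2 :=
        mul_le_of_le_one_left (by positivity) (hχ1 k x)
      have hmul := mul_le_mul_of_nonneg_left hamgm (hχ0 k x)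
      have ha2 : a ^ 2 = ‖fderiv ℝ g x‖ ^ 2 * (r + ‖x‖) ^ 2 := by rw [ha]; ring
      calc ‖fderiv ℝ (fun x => u x ^ 2 * χ k x) x‖ * (r + ‖x‖)
          ≤ (u x ^ 2 * ‖fderiv ℝ (χ k) x‖ + χ k x * (2 * u x * ‖fderiv ℝ g x‖)) * (r + ‖x‖) := by
            gcongr
        _ = u x ^ 2 * (‖fderiv ℝ (χ k) x‖ * (r + ‖x‖)) + χ k x * (2 * u x * a) := by
            rw [ha]; ring
        _ ≤ c / 2 * (u x ^ 2 * χ k x) + 2 / c * a ^ 2 +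
            u x ^ 2 * (‖fderiv ℝ (χ k) x‖ * (r + ‖x‖)) := by linarith
        _ = _ := by rw [ha2]
  have ev : ∀ x : E, ∀ᶠ k : ℕ in Filter.atTop, ‖x‖ < ((k + 1 : ℕ) : ℝ) := by
    intro x
    obtain ⟨N, hN⟩ := exists_nat_gt ‖x‖
    filter_upwards [Filter.eventually_ge_atTop N] with k hk
    refine hN.trans_le ?_
    exact_mod_cast hk.trans (Nat.le_succ k)
  have lim1 : Filter.Tendsto (fun k => ∫ x, u x ^ 2 * χ k x ∂μ) Filter.atTop
      (nhds (∫ x, u x ^ 2 ∂μ)) := by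
    refine tendsto_integral_of_dominated_convergence (fun _ => (M + |m|) ^ 2)
      (fun k => (hi1 k).aestronglyMeasurable) (integrable_const _)
      (fun k => Filter.Eventually.of_forall fun x => ?_) (Filter.Eventually.of_forall fun x => ?_)
    · rw [Real.norm_of_nonneg (mul_nonneg (sq_nonneg _) (hχ0 k x))]
      exact (mul_le_of_le_one_right (sq_nonneg _) (hχ1 k x)).trans
        (pow_le_pow_left₀ (hu0 x) (hub x) 2)
    · refine tendsto_const_nhds.congr' ?_
      filter_upwards [ev x] with k hk
      rw [hχk k x hk, mul_one]
  have lim2 : Filter.Tendsto (fun k => ∫ x, u x ^ 2 * (‖fderiv ℝ (χ k) x‖ * (r + ‖x‖)) ∂μ)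
      Filter.atTop (nhds 0) := by
    rw [← integral_zero E ℝ (μ := μ)]
    refine tendsto_integral_of_dominated_convergence
      (fun _ => (M + |m|) ^ 2 * ((1 + r) * K)) (fun k => (hi2 k).aestronglyMeasurable)
      (integrable_const _) (fun k => Filter.Eventually.of_forall fun x => ?_)
      (Filter.Eventually.of_forall fun x => ?_)
    · have hx0 := norm_nonneg x
      rw [Real.norm_of_nonneg (by positivity)]
      refine mul_le_mul (pow_le_pow_left₀ (hu0 x) (hub x) 2) ?_ (by positivity) (by positivity)
      calc ‖fderiv ℝ (χ k) x‖ * (r + ‖x‖) ≤ ‖fderiv ℝ (χ k) x‖ * ((1 + r) * (1 + ‖x‖)) := by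
            gcongr
            nlinarith
        _ = (1 + r) * (‖fderiv ℝ (χ k) x‖ * (1 + ‖x‖)) := by ring
        _ ≤ (1 + r) * K := by gcongr; exact hχK k x
    · refine tendsto_const_nhds.congr' ?_
      filter_upwards [ev x] with k hk
      have hloc : χ k =ᶠ[nhds x] fun _ => (1 : ℝ) := by
        filter_upwards [continuous_norm.continuousAt.eventually (gt_mem_nhds hk)] with y hy
        exact hχk k y hy
      simp [hloc.fderiv_eq]
  have hlim := le_of_tendsto_of_tendsto' (lim1.const_mul c)
    (((lim1.const_mul (c / 2)).add_const (2 / c * I)).add lim2) step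
  rw [add_zero] at hlim
  have hfin : c / 2 * ∫ x, u x ^ 2 ∂μ ≤ 2 / c * I := by linarith
  calc ∫ x, u x ^ 2 ∂μ = 2 / c * (c / 2 * ∫ x, u x ^ 2 ∂μ) := by field_simp
    _ ≤ 2 / c * (2 / c * I) := by gcongr
    _ = 4 / c ^ 2 * I := by field_simp; ring

/-! ### Medians and the variance -/

theorem exists_median {Ω : Type*} [MeasurableSpace Ω] {μ : Measure Ω} [IsProbabilityMeasure μ]
    {g : Ω → ℝ} (hg : Measurable g) {M : ℝ}
    (hM : ∀ x, |g x| ≤ M) :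
    ∃ m : ℝ, μ {x | m < g x} ≤ 1 / 2 ∧ μ {x | g x < m} ≤ 1 / 2 := by
  set S : Set ℝ := {s | μ {x | s < g x} ≤ 1 / 2} with hS
  have hMS : M ∈ S := by
    have : {x | M < g x} = ∅ := by
      ext x
      simpa using (le_abs_self _).trans (hM x)
    simp [hS, this]
  have hbdd : BddBelow S := by
    refine ⟨-M, fun s hs => ?_⟩
    by_contra! hlt
    have huniv : {x | s < g x} = Set.univ := by
      ext x
      simpa using hlt.trans_le (neg_le_of_abs_le (hM x))
    have hs' : μ {x | s < g x} ≤ 1 / 2 := hs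
    rw [huniv, measure_univ] at hs'
    norm_num at hs'
  refine ⟨sInf S, ?_, ?_⟩
  · have hun : {x | sInf S < g x} = ⋃ k : ℕ, {x | sInf S + 1 / ((k : ℝ) + 1) < g x} := by
      ext x
      simp only [Set.mem_ofPred_eq, Set.mem_iUnion]
      refine ⟨fun hx => ?_, fun ⟨k, hk⟩ => lt_trans (by simp; positivity) hk⟩
      obtain ⟨k, hk⟩ := exists_nat_one_div_lt (sub_pos.2 hx)
      exact ⟨k, by linarith⟩
    rw [hun]
    refine le_of_tendsto (tendsto_measure_iUnion_atTop fun k l hkl x hx => ?_)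
      (Filter.Eventually.of_forall fun k => ?_)
    · have h1 : 1 / ((l : ℝ) + 1) ≤ 1 / ((k : ℝ) + 1) := by gcongr
      have h2 : sInf S + 1 / ((k : ℝ) + 1) < g x := hx
      show sInf S + 1 / ((l : ℝ) + 1) < g x
      linarith
    · obtain ⟨s, hs, hsk⟩ := exists_lt_of_csInf_lt ⟨M, hMS⟩
        (show sInf S < sInf S + 1 / ((k : ℝ) + 1) by simp; positivity)
      exact (measure_mono fun x hx => lt_trans hsk hx).trans hs
  · have hun : {x | g x < sInf S} = ⋃ k : ℕ, {x | g x ≤ sInf S - 1 / ((k : ℝ) + 1)} := by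
      ext x
      simp only [Set.mem_ofPred_eq, Set.mem_iUnion]
      refine ⟨fun hx => ?_, fun ⟨k, hk⟩ => lt_of_le_of_lt hk (by simp; positivity)⟩
      obtain ⟨k, hk⟩ := exists_nat_one_div_lt (sub_pos.2 hx)
      exact ⟨k, by linarith⟩
    rw [hun]
    refine le_of_tendsto (tendsto_measure_iUnion_atTop fun k l hkl x hx => ?_)
      (Filter.Eventually.of_forall fun k => ?_)
    · have h1 : 1 / ((l : ℝ) + 1) ≤ 1 / ((k : ℝ) + 1) := by gcongr
      have h2 : g x ≤ sInf S - 1 / ((k : ℝ) + 1) := hx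
      show g x ≤ sInf S - 1 / ((l : ℝ) + 1)
      linarith
    · set s := sInf S - 1 / ((k : ℝ) + 1) with hs
      have hsS : s ∉ S := notMem_of_lt_csInf (by rw [hs]; simp; positivity) hbdd
      have h1 : 1 / 2 < μ {x | s < g x} := not_le.1 hsS
      have hcompl : {x | g x ≤ s} = {x | s < g x}ᶜ := by ext x; simp
      show μ {x | g x ≤ s} ≤ 1 / 2
      rw [hcompl, prob_compl_eq_one_sub (measurableSet_lt measurable_const hg)]
      refine (tsub_le_tsub_left h1.le 1).trans (le_of_eq ?_)
      simp

/-- The variance is at most the second moment about a median, which splits into the positive parts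
of `g - m` and `m - g`. -/
theorem variance_le_of_weighted_cheeger [InnerProductSpace ℝ E] [FiniteDimensional ℝ E]
    [BorelSpace E] [IsProbabilityMeasure μ] (hr : 0 ≤ r) (hc : 0 < c)
    (hμ : ∀ f : E → ℝ, ContDiff ℝ 1 f → HasCompactSupport f → (∀ x, 0 ≤ f x) →
      μ {x | 0 < f x} ≤ 1 / 2 → c * ∫ x, f x ∂μ ≤ ∫ x, ‖fderiv ℝ f x‖ * (r + ‖x‖) ∂μ)
    {g : E → ℝ} (hg : ContDiff ℝ 1 g) {M : ℝ} (hM : ∀ x, |g x| ≤ M)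
    (hG : Integrable (fun x => ‖fderiv ℝ g x‖ ^ 2 * (r + ‖x‖) ^ 2) μ) :
    Var[g; μ] ≤ 8 / c ^ 2 * ∫ x, ‖fderiv ℝ g x‖ ^ 2 * (r + ‖x‖) ^ 2 ∂μ := by
  obtain ⟨m, hm1, hm2⟩ := exists_median (μ := μ) hg.continuous.measurable hM
  have hgm : AEStronglyMeasurable g μ := hg.continuous.aestronglyMeasurable
  have hpos := integral_posPart_sq_le hr hc hμ hg hM hm1 hG
  have hneg := integral_posPart_sq_le hr hc hμ (g := fun x => -g x) hg.neg (M := M)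
    (fun x => by simpa using hM x) (m := -m) (by simpa using hm2)
    (by simpa [fderiv_fun_neg] using hG)
  simp only [fderiv_fun_neg, norm_neg] at hneg
  have bdd : ∀ φ : E → ℝ, Continuous φ → (∀ x, |φ x| ≤ M + |m|) →
      Integrable (fun x => max (φ x) 0 ^ 2) μ := by
    intro φ hφ hb
    refine Integrable.of_bound (by fun_prop) ((M + |m|) ^ 2)
      (Filter.Eventually.of_forall fun x => ?_)
    rw [Real.norm_of_nonneg (sq_nonneg _)]
    refine pow_le_pow_left₀ (le_max_right _ _) (max_le ((le_abs_self _).trans (hb x)) ?_) 2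
    exact (abs_nonneg _).trans (hb x)
  have hgc := hg.continuous
  have hi1 := bdd (fun x => g x - m) (by fun_prop) fun x =>
    (abs_sub _ _).trans (by have := hM x; linarith)
  have hi2 := bdd (fun x => -g x - -m) (by fun_prop) fun x =>
    (abs_sub _ _).trans (by have := hM x; simp only [abs_neg]; linarith)
  calc Var[g; μ] = Var[fun x => g x - m; μ] := (variance_sub_const hgm m).symm
    _ ≤ ∫ x, (g x - m) ^ 2 ∂μ :=
      variance_le_expectation_sq (X := fun x => g x - m) (by fun_prop)
    _ = ∫ x, (max (g x - m) 0 ^ 2 + max (-g x - -m) 0 ^ 2) ∂μ := by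
      congr 1
      ext x
      rcases le_total (g x) m with h | h
      · rw [max_eq_right (by linarith), max_eq_left (by linarith)]; ring
      · rw [max_eq_left (by linarith), max_eq_right (by linarith)]; ring
    _ = (∫ x, max (g x - m) 0 ^ 2 ∂μ) + ∫ x, max (-g x - -m) 0 ^ 2 ∂μ := integral_add hi1 hi2
    _ ≤ 8 / c ^ 2 * ∫ x, ‖fderiv ℝ g x‖ ^ 2 * (r + ‖x‖) ^ 2 ∂μ := by
      refine (add_le_add hpos hneg).trans (le_of_eq ?_)
      ring

end Weighted

/-! ### The weighted Poincaré inequality -/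

theorem norm_gradient_eq_norm_fderiv {E : Type*} [NormedAddCommGroup E] [InnerProductSpace ℝ E]
    [CompleteSpace E] (g : E → ℝ) (x : E) : ‖gradient g x‖ = ‖fderiv ℝ g x‖ := by
  rw [gradient, LinearIsometryEquiv.norm_map]

theorem theorem5p1 :
    ∃ C : ℝ, 0 < C ∧
      ∀ (n : ℕ) (_ : 1 ≤ n) (β : ℝ) (_ : (n : ℝ) < β)
        (V : EuclideanSpace ℝ (Fin n) → ℝ≥0∞) (_ : ∀ x, 0 < V x)
        (_ : ConvexOn ℝ≥0 Set.univ V)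
        (μ : Measure (EuclideanSpace ℝ (Fin n))) (_ : μ = convexPowerMeasure n β V)
        (_ : IsProbabilityMeasure μ),
        (∃! r : ℝ, 0 < r ∧ μ {x | ‖x‖ ≤ r} = 2 / 3) ∧
        ∀ r : ℝ, 0 < r → μ {x | ‖x‖ ≤ r} = 2 / 3 →
          ∀ g : EuclideanSpace ℝ (Fin n) → ℝ, ContDiff ℝ ∞ g → (∃ M : ℝ, ∀ x, |g x| ≤ M) →
            ENNReal.ofReal (Var[g; μ]) ≤
              ENNReal.ofReal (C * ((β - n + 1) / (β - n)) ^ 2) *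
                ∫⁻ x, ENNReal.ofReal (‖gradient g x‖ ^ 2 * (r ^ 2 + ‖x‖ ^ 2)) ∂μ := by
  -- The chain below gives `8 / c²` with `c = α / (4 (α + 1))` and `α = β - n`, and
  -- `(r + ‖x‖)² ≤ 2 (r² + ‖x‖²)` doubles it to `256 ((α + 1) / α)²`.
  refine ⟨256, by norm_num, fun n hn β hβ V hV0 hV μ hμ _ => ⟨?_, ?_⟩⟩
  · have hβ0 : 0 < β := n.cast_nonneg.trans_lt hβ
    have hac : μ ≪ volume := hμ ▸ convexPowerMeasure_absolutelyContinuous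
    have h23 : ENNReal.ofReal (2 / 3) = 2 / 3 := by
      rw [ENNReal.ofReal_div_of_pos (by norm_num)]; simp
    have h23_ne : (2 / 3 : ℝ≥0∞) ≠ 0 := by simp
    have h23_lt : (2 / 3 : ℝ≥0∞) < 1 := by
      rw [← h23]; exact ENNReal.ofReal_lt_one.2 (by norm_num)
    have hball : ∀ s : ℝ, MeasurableSet {x : EuclideanSpace ℝ (Fin n) | ‖x‖ ≤ s} := fun s =>
      measurableSet_le measurable_norm measurable_const
    -- Two distinct radii would bound a null shell with mass on either side.
    have no_gap : ∀ s₁ s₂ : ℝ, s₁ < s₂ → μ {x | ‖x‖ ≤ s₁} = 2 / 3 → μ {x | ‖x‖ ≤ s₂} ≠ 2 / 3 := by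
      intro s₁ s₂ hs h₁ h₂
      refine convexPowerMeasure_shell_pos (n := n) (V := V) hβ0 hV0 hV hs ?_ ?_ ?_
      · rw [← hμ, h₁]; exact h23_ne
      · rw [← hμ, prob_compl_eq_one_sub (hball _), h₂]
        exact (tsub_pos_of_lt h23_lt).ne'
      · rw [← hμ]
        refine measure_mono_null (t := {x | ‖x‖ ≤ s₂} \ {x | ‖x‖ ≤ s₁})
          (fun x hx => ⟨hx.2.le, not_le.2 hx.1⟩) ?_
        have hsub : {x : EuclideanSpace ℝ (Fin n) | ‖x‖ ≤ s₁} ⊆ {x | ‖x‖ ≤ s₂} :=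
          fun x (hx : ‖x‖ ≤ s₁) => hx.trans hs.le
        rw [measure_sdiff hsub (hball _).nullMeasurableSet
          (measure_ne_top _ _), h₁, h₂, tsub_self]
    obtain ⟨r, hr0, hr⟩ := exists_radius_of_absolutelyContinuous hn hac (p := 2 / 3)
      (by norm_num) (by norm_num)
    rw [h23] at hr
    refine ⟨r, ⟨hr0, hr⟩, fun s hs => ?_⟩
    rcases lt_trichotomy s r with h | h | h
    · exact absurd hr (no_gap s r h hs.2)
    · exact h
    · exact absurd hs.2 (no_gap r s h hr)
  · rintro r hr0 hr g hg ⟨M, hM⟩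
    set α := β - n with hα_def
    have hα : 0 < α := by rw [hα_def]; linarith
    set c := α / (4 * (α + 1)) with hc_def
    have hc : 0 < c := by positivity
    have expansion : ∀ t : ℝ, 0 < t → t < 1 → ∀ A D : Set (EuclideanSpace ℝ (Fin n)),
        MeasurableSet A → MeasurableSet D → μ A ≤ 1 / 2 →
        (∀ x ∈ A, ∀ b : EuclideanSpace ℝ (Fin n), ‖b‖ ≤ r → (1 - t) • x + t • b ∈ D) →
        ENNReal.ofReal (1 + t * c) * μ A ≤ μ D := by
      intro t ht0 ht1 A D hA hD hA2 hAD
      have hball : MeasurableSet {x : EuclideanSpace ℝ (Fin n) | ‖x‖ ≤ r} :=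
        measurableSet_le measurable_norm measurable_const
      have hsum : (⟨1 - t, by linarith⟩ : ℝ≥0) + ⟨t, ht0.le⟩ = 1 := by
        ext; simp
      have h := powMean_convexPowerMeasure_le (V := V) hβ hV (u := ⟨1 - t, by linarith⟩)
        (v := ⟨t, ht0.le⟩) (sub_pos.2 ht1) ht0 hsum hA hball hD fun x hx b hb => hAD x hx b hb
      rw [← hμ, hr] at h
      exact (mul_le_powMean hα hsum hA2).trans h
    have hL1 := fun f hf hfc hf0 hfm => mul_integral_le_of_expansion (μ := μ) (f := f) hr0.le hc.le
      expansion hf hfc hf0 hfm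
    have hg1 : ContDiff ℝ 1 g := hg.of_le (by exact_mod_cast le_top)
    simp only [norm_gradient_eq_norm_fderiv]
    have hDc : Continuous fun x => ‖fderiv ℝ g x‖ := (hg1.continuous_fderiv one_ne_zero).norm
    set F : EuclideanSpace ℝ (Fin n) → ℝ := fun x => ‖fderiv ℝ g x‖ ^ 2 * (r ^ 2 + ‖x‖ ^ 2) with hF
    have hFc : Continuous F := by fun_prop
    have hF0 : ∀ x, 0 ≤ F x := fun x => by positivity
    rcases eq_or_ne (∫⁻ x, ENNReal.ofReal (F x) ∂μ) ⊤ with htop | hfin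
    · rw [htop, ENNReal.mul_top (ENNReal.ofReal_pos.2 (by positivity)).ne']
      exact le_top
    have hFi : Integrable F μ :=
      ⟨hFc.aestronglyMeasurable, (hasFiniteIntegral_iff_ofReal
        (Filter.Eventually.of_forall hF0)).2 hfin.lt_top⟩
    have hle : ∀ x, ‖fderiv ℝ g x‖ ^ 2 * (r + ‖x‖) ^ 2 ≤ 2 * F x := fun x => by
      have h1 : (r + ‖x‖) ^ 2 ≤ 2 * (r ^ 2 + ‖x‖ ^ 2) := add_sq_le
      have h2 := mul_le_mul_of_nonneg_left h1 (sq_nonneg ‖fderiv ℝ g x‖)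
      simp only [hF]
      linarith
    have hG : Integrable (fun x => ‖fderiv ℝ g x‖ ^ 2 * (r + ‖x‖) ^ 2) μ := by
      refine (hFi.const_mul 2).mono' (by fun_prop) (Filter.Eventually.of_forall fun x => ?_)
      rw [Real.norm_of_nonneg (by positivity)]
      exact hle x
    have hvar := variance_le_of_weighted_cheeger hr0.le hc hL1 hg1 hM hG
    rw [← ofReal_integral_eq_lintegral_ofReal hFi (Filter.Eventually.of_forall hF0),
      ← ENNReal.ofReal_mul (by positivity)]
    refine ENNReal.ofReal_le_ofReal (hvar.trans ?_)
    calc 8 / c ^ 2 * ∫ x, ‖fderiv ℝ g x‖ ^ 2 * (r + ‖x‖) ^ 2 ∂μ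
        ≤ 8 / c ^ 2 * ∫ x, 2 * F x ∂μ := by
          exact mul_le_mul_of_nonneg_left (integral_mono hG (hFi.const_mul 2) hle) (by positivity)
      _ = 256 * ((α + 1) / α) ^ 2 * ∫ x, F x ∂μ := by
          rw [integral_const_mul, hc_def]
          field_simp
          ring
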